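/- Let $N\ge 1$ and let $S=\mathbb Z^2$ (bulk) or $S=\mathbb Z\times\mathbb N=\{x\in\mathbb Z^2: x_2\ge 0\}$ (edge), and let $\mathcal H=\ell^2(S)\otimes\mathbb C^N$. For a bounded operator $A$ on $\mathcal H$ and $x,y\in S$ let $A_{xy}=\langle\delta_x,A\delta_y\rangle$ be the corresponding $N\times N$ block. * $A$ is *weakly-local* if there is $\nu\in\mathbb N$ such that for every sufficiently large $\mu\in\mathbb N$ there is $C_\mu<\infty$ with $\|A_{xy}\|\le C_\mu(1+\|x-y\|)^{-\mu}(1+\|x\|)^{\nu}$ for all $x,y\in S$. * $A$ is *weakly-local and confined in direction $j$* ($j=1,2$) if there is $\nu>0$ such that for every sufficiently large $\mu$ there is $C_\mu<\infty$ with $\|A_{xy}\|\le C_\mu(1+\|x-y\|)^{-\mu}(1+|x_j|)^{-\mu}(1+\|x\|)^{\nu}$ for all $x,y\in S$. * $A$ is a *$2$-quasi-projection* if $A$ is self-adjoint and weakly-local, and $A^2-A$ is weakly-local and confined in direction $2$. Let $\Lambda_1$ be the orthogonal projection onto the functions supported in $\{x\in S: x_1\ge 0\}$, and put $\mathbb W_1A=\Lambda_1\exp(-2\pi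 i A)\Lambda_1+(1-\Lambda_1)$. For a Fredholm operator $F$ let $\operatorname{index}F=\dim\ker F-\dim\ker F^*$. Then: 1. If $A$ is a $2$-quasi-projection, then $\mathbb W_1A$ is Fredholm. 2. If $[0,1]\ni t\mapsto A(t)$ is a norm-continuous family of $2$-quasi-projections, then $t\mapsto\operatorname{index}\mathbb W_1A(t)\in\mathbb Z$ is locally constant. 3. The same holds for the $\mathbb Z_2$-index. Let $\Theta$ be a time-reversal symmetry of $\mathcal H$, i.e. a conjugate-linear map with $\langle\Theta\psi,\Theta\varphi\rangle=\langle\varphi,\psi\rangle$ and $\Theta^2=-1$ that commutes with the position operators $X_1,X_2$. Call a Fredholm operator $F$ *$\Theta$-odd* if $F=-\Theta F^*\Theta$, and put $\operatorname{index}_2F=\dim\ker F\bmod 2$ for such $F$. If $A$ is a $2$-quasi-projection with $[A,\Theta]=0$, then $\mathbb W_1A$ is $\Theta$-odd. If $[0,1]\ni t\mapsto A(t)$ is a norm-continuous family of $2$-quasi-projections such that every $\mathbb W_1A(t)$ is $\Theta$-odd, then $t\mapsto\operatorname{index}_2\mathbb W_1A(t)\in\mathbb Z_2$ is locally constant. 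-/

import Mathlib

open scoped ENNReal

noncomputable section

namespace MobilityGap

/-- The two coordinate directions of the lattice `ℤ²`. -/
inductive Direction
  | first
  | second

/-- The coordinate `x_j` of a lattice point. -/
def coord : Direction → ℤ × ℤ → ℤ
  | .first, x => x.1
  | .second, x => x.2

/-- The sites of the bulk (infinite) sample: the whole lattice `ℤ²`. -/
def bulkSites : Set (ℤ × ℤ) := Set.univ

/-- The sites of the edge (half-infinite) sample: `ℤ × ℕ`, as a subset of `ℤ²`. -/
def edgeSites : Set (ℤ × ℤ) := {x | 0 ≤ x.2}

/-- The Hilbert space `ℓ²(S) ⊗ ℂᴺ = ℓ²(S; ℂᴺ)` over a set of sites `S ⊆ ℤ²`. -/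
abbrev Space (S : Set (ℤ × ℤ)) (N : ℕ) : Type :=
  lp (fun _ : S => EuclideanSpace ℂ (Fin N)) 2

/-- Bounded operators on `ℓ²(S; ℂᴺ)`, with the operator norm. -/
abbrev Op (S : Set (ℤ × ℤ)) (N : ℕ) : Type := Space S N →L[ℂ] Space S N

variable {S : Set (ℤ × ℤ)} {N : ℕ}

/-- The block `A_{xy} = ⟨δ_x, A δ_y⟩`, an operator on `ℂᴺ`; it carries the operator norm. -/
def block (A : Op S N) (x y : S) : EuclideanSpace ℂ (Fin N) →L[ℂ] EuclideanSpace ℂ (Fin N) :=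
  (lp.evalCLM ℂ (fun _ : S => EuclideanSpace ℂ (Fin N)) 2 x) ∘L A ∘L
    (lp.singleContinuousLinearMap ℂ (fun _ : S => EuclideanSpace ℂ (Fin N)) 2 y)

/-- Weakly-local operators. Here `‖·‖` on `ℤ × ℤ` is the maximum norm; any other norm
only changes the constants. -/
def IsWeaklyLocal (A : Op S N) : Prop :=
  ∃ ν : ℕ, ∀ᶠ μ : ℕ in Filter.atTop, ∃ C : ℝ, ∀ x y : S,
    ‖block A x y‖ ≤ C * ((1 + ‖(x : ℤ × ℤ) - (y : ℤ × ℤ)‖) ^ μ)⁻¹ * (1 + ‖(x : ℤ × ℤ)‖) ^ ν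

/-- Operators that are weakly-local and confined in direction `j`. -/
def IsConfined (j : Direction) (A : Op S N) : Prop :=
  ∃ ν : ℕ, 0 < ν ∧ ∀ᶠ μ : ℕ in Filter.atTop, ∃ C : ℝ, ∀ x y : S,
    ‖block A x y‖ ≤ C * ((1 + ‖(x : ℤ × ℤ) - (y : ℤ × ℤ)‖) ^ μ)⁻¹ *
      ((1 + |(coord j x : ℝ)|) ^ μ)⁻¹ * (1 + ‖(x : ℤ × ℤ)‖) ^ ν

/-- `j`-quasi-projections. -/
structure IsQuasiProjection (j : Direction) (A : Op S N) : Prop where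
  isSelfAdjoint : IsSelfAdjoint A
  isWeaklyLocal : IsWeaklyLocal A
  isConfined : IsConfined j (A * A - A)

/-- The function `ψ` cut off to the half-space `{x | 0 ≤ x_j}`. -/
def cutoff (j : Direction) (ψ : S → EuclideanSpace ℂ (Fin N)) (x : S) :
    EuclideanSpace ℂ (Fin N) :=
  if 0 ≤ coord j x then ψ x else 0

lemma norm_cutoff_le (j : Direction) (ψ : S → EuclideanSpace ℂ (Fin N)) (x : S) :
    ‖cutoff j ψ x‖ ≤ ‖ψ x‖ := by
  unfold cutoff
  split_ifs
  · exact le_rfl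
  · simp

lemma memlp_cutoff (j : Direction) (ψ : Space S N) :
    Memℓp (cutoff j (ψ : S → EuclideanSpace ℂ (Fin N))) 2 :=
  Memℓp.mono' (lp.memℓp ψ) (norm_cutoff_le j _)

/-- The orthogonal projection `Λ_j` onto the functions supported in `{x | 0 ≤ x_j}`. -/
def halfSpaceProj (j : Direction) : Op S N :=
  LinearMap.mkContinuous
    { toFun := fun ψ => ⟨cutoff j ψ, memlp_cutoff j ψ⟩
      map_add' := fun ψ φ => by
        ext1; funext x
        change cutoff j (⇑ψ + ⇑φ) x = cutoff j ⇑ψ x + cutoff j ⇑φ x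
        by_cases h : 0 ≤ coord j x <;> simp [cutoff, h]
      map_smul' := fun c ψ => by
        ext1; funext x
        by_cases h : 0 ≤ coord j x <;> simp [cutoff, h] }
    1 (fun ψ => by
      rw [one_mul]
      exact lp.norm_mono (by norm_num) (norm_cutoff_le j _))

/-- The compression `Λ_j G Λ_j + (1 - Λ_j)` of `G` to the half-space `{x | 0 ≤ x_j}`. -/
def compress (j : Direction) (G : Op S N) : Op S N :=
  halfSpaceProj j * G * halfSpaceProj j + (1 - halfSpaceProj j)

/-- The operator `Λ_j exp(-2πiA) Λ_j + (1 - Λ_j)`. -/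
def W (j : Direction) (A : Op S N) : Op S N :=
  compress j (NormedSpace.exp ((-2 * (Real.pi : ℂ) * Complex.I) • A))

/-- The Fredholm index `dim ker F - dim ker F*`, meaningful for Fredholm `F`. -/
def index (F : Op S N) : ℤ :=
  (Module.finrank ℂ F.ker : ℤ) - (Module.finrank ℂ (ContinuousLinearMap.adjoint F).ker : ℤ)

/-- The `ℤ₂`-index `dim ker F mod 2`, meaningful for Fredholm `F` that are `Θ`-odd. -/
def indexTwo (F : Op S N) : ZMod 2 := (Module.finrank ℂ F.ker : ZMod 2)

/-- A fermionic time-reversal symmetry: a conjugate-linear anti-unitary map `Θ` with `Θ² = -1`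
that commutes with the position operators `X_j`. For the (unbounded) operators `X_j` the latter
says: if `ψ` is in the domain of `X_j`, then so is `Θψ`, and `X_j Θψ = Θ X_j ψ`. -/
structure IsTimeReversal (Θ : Space S N →ₛₗ[starRingEnd ℂ] Space S N) : Prop where
  inner_map : ∀ ψ φ, inner ℂ (Θ ψ) (Θ φ) = inner ℂ φ ψ
  map_map : ∀ ψ, Θ (Θ ψ) = -ψ
  map_position : ∀ (j : Direction) (ψ φ : Space S N),
    (∀ x : S, φ x = (coord j x : ℂ) • ψ x) → ∀ x : S, (Θ φ) x = (coord j x : ℂ) • (Θ ψ) x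

/-- `A` is time-reversal invariant: `[A, Θ] = 0`. -/
def IsTimeReversalInvariant (Θ : Space S N →ₛₗ[starRingEnd ℂ] Space S N) (A : Op S N) : Prop :=
  ∀ ψ, A (Θ ψ) = Θ (A ψ)

/-- `F` is `Θ`-odd: `F = -Θ F* Θ`. -/
def IsThetaOdd (Θ : Space S N →ₛₗ[starRingEnd ℂ] Space S N) (F : Op S N) : Prop :=
  ∀ ψ, F ψ = -Θ (ContinuousLinearMap.adjoint F (Θ ψ))

end MobilityGap

end

/-!
Write `Λ` for the half-space projection in direction `1`, `U = exp(-2πiA)`, and `𝒦` for the norm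
closure of the finite-rank operators, a closed two-sided ideal (`approxFiniteRank`).

*Fredholm property.* If `[Λ, U] ∈ 𝒦`, then `Λ U⁻¹ Λ + (1 - Λ)` is a parametrix of
`Λ U Λ + (1 - Λ)` modulo `𝒦` (`isFredholm_compress`), and an operator invertible modulo `𝒦` is
Fredholm (`isFredholm_of_mul_sub_one_mem`). No locality of `U` or of resolvents of `A` is needed
for `[Λ, U] ∈ 𝒦`. Put `Q = A² - A`. As `exp(-2πiz) - 1` vanishes at `0` and `1`,
`U = 1 + Q g(A)` with `g` entire, and `[Λ, U] = [Λ, Q] g(A) + Q [Λ, g(A)]`. Since `Q` commutes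
with `A`, the operators `B` commuting with `Q` with `Q [Λ, B] ∈ 𝒦` form a closed algebra, so that
`Q [Λ, A] ∈ 𝒦` suffices for the second term (`mul_commutator_cfc_mem`). The inputs
`[Λ, Q] ∈ 𝒦` and `Q [Λ, A] ∈ 𝒦` come from kernel bounds: a commutator with `Λ` decays in `|x₁|`,
and `Q` decays in `|x₂|`. In the product `Q [Λ, A]` one inserts the projection `D` onto the cone
`|x₁| ≤ |x₂|`: both `Q D` and `(1 - D) [Λ, A]` have summable kernels. The polynomial growth allowed
by weak locality is absorbed by the arbitrarily fast decay (`mem_approxFiniteRank_of_decay`).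

*Stability.* For a Fredholm operator `F` and `G` near `F`, the operator `G` bordered by `ker F*`
and by the projection onto `ker F` is invertible, because it is so for `G = F`. Hence
`X = G⁻¹(ker F*)` is isomorphic to `ker F`, and the exact sequence
`0 → ker G → X → ker F* → coker G → 0` gives the stability of the index
(`finrank_ker_add_of_bordered`, `eventually_index_eq`). If `F` and `G` are `Θ`-odd, then
`⟨Θφ, Gψ⟩` is an antisymmetric bilinear form on `X` with kernel `ker G`. Its rank
`dim ker F - dim ker G` is even (`eventually_finrank_ker_parity_eq`).

*Time reversal.* `Θ` acts site by site and so commutes with `Λ`. The map `B ↦ -Θ B Θ` is a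
continuous conjugate-linear ring homomorphism, which sends `U* = exp(2πiA)` to `U` when `Θ`
commutes with `A` (`IsTimeReversal.isThetaOdd_W`).
-/

open scoped ENNReal

noncomputable section

namespace MobilityGap

/-! ### Norm limits of finite-rank operators and the Fredholm property -/

section FiniteRank

variable {𝕜 E : Type*} [NontriviallyNormedField 𝕜] [NormedAddCommGroup E] [NormedSpace 𝕜 E]

variable (𝕜 E) in
/-- The norm closure of the finite-rank operators. On a Hilbert space these are the compact
operators, but only the approximation property is needed. -/
def approxFiniteRank : Submodule 𝕜 (E →L[𝕜] E) :=
  Submodule.topologicalClosure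
    { carrier := {T | (T : E →ₗ[𝕜] E).HasFiniteRange}
      add_mem' := fun hS hT => LinearMap.HasFiniteRange.add hS hT
      zero_mem' := LinearMap.HasFiniteRange.zero
      smul_mem' := fun c _ hT => LinearMap.HasFiniteRange.smul hT c }

lemma mem_approxFiniteRank_iff {T : E →L[𝕜] E} :
    T ∈ approxFiniteRank 𝕜 E ↔
      T ∈ closure {R : E →L[𝕜] E | (R : E →ₗ[𝕜] E).HasFiniteRange} :=
  Iff.rfl

lemma isClosed_approxFiniteRank : IsClosed (approxFiniteRank 𝕜 E : Set (E →L[𝕜] E)) :=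
  Submodule.isClosed_topologicalClosure _

lemma mem_approxFiniteRank_of_hasFiniteRange {T : E →L[𝕜] E}
    (hT : (T : E →ₗ[𝕜] E).HasFiniteRange) : T ∈ approxFiniteRank 𝕜 E :=
  subset_closure hT

lemma mul_mem_approxFiniteRank_left {T : E →L[𝕜] E} (hT : T ∈ approxFiniteRank 𝕜 E)
    (B : E →L[𝕜] E) : B * T ∈ approxFiniteRank 𝕜 E :=
  map_mem_closure (continuous_const_mul B) hT fun _ hR =>
    LinearMap.HasFiniteRange.comp_left hR (B : E →ₗ[𝕜] E)

lemma mul_mem_approxFiniteRank_right {T : E →L[𝕜] E} (hT : T ∈ approxFiniteRank 𝕜 E)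
    (B : E →L[𝕜] E) : T * B ∈ approxFiniteRank 𝕜 E :=
  map_mem_closure (f := fun R => R * B) (continuous_mul_const B) hT fun _ hR =>
    LinearMap.HasFiniteRange.comp_right hR (B : E →ₗ[𝕜] E)

/-- A perturbation `1 + T` of the identity, with `T` a norm limit of finite-rank operators, is
invertible up to finite rank: `T` is of finite rank up to an error of norm less than one. -/
lemma exists_isUnit_add_hasFiniteRange [CompleteSpace E] {T : E →L[𝕜] E}
    (hT : T ∈ approxFiniteRank 𝕜 E) :
    ∃ J R : E →L[𝕜] E, IsUnit J ∧ (R : E →ₗ[𝕜] E).HasFiniteRange ∧ 1 + T = J + R := by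
  obtain ⟨R, hR, hTR⟩ := Metric.mem_closure_iff.1 (mem_approxFiniteRank_iff.1 hT) 1 one_pos
  rw [dist_comm, dist_eq_norm] at hTR
  refine ⟨1 - (R - T), R, (Units.oneSub _ hTR).isUnit, hR, by abel⟩

open scoped LinearMap.FiniteRangeSetoid in
/-- An operator that is invertible modulo norm limits of finite-rank operators is Fredholm. -/
theorem isFredholm_of_mul_sub_one_mem [CompleteSpace 𝕜] [CompleteSpace E] {V W : E →L[𝕜] E}
    (hVW : V * W - 1 ∈ approxFiniteRank 𝕜 E) (hWV : W * V - 1 ∈ approxFiniteRank 𝕜 E) :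
    W.IsFredholm := by
  obtain ⟨J₁, R₁, ⟨u₁, rfl⟩, hR₁, h₁⟩ := exists_isUnit_add_hasFiniteRange hVW
  obtain ⟨J₂, R₂, ⟨u₂, rfl⟩, hR₂, h₂⟩ := exists_isUnit_add_hasFiniteRange hWV
  rw [add_sub_cancel] at h₁ h₂
  set L : E →L[𝕜] E := ↑u₁⁻¹ * V
  set R : E →L[𝕜] E := V * ↑u₂⁻¹
  have hL : (L : E →ₗ[𝕜] E) ∘ₗ (W : E →ₗ[𝕜] E) ≈ .id := by
    rw [LinearMap.FiniteRangeSetoid.equiv_iff_hasFiniteRange]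
    have : L * W - 1 = ↑u₁⁻¹ * R₁ := by
      rw [mul_assoc, h₁, mul_add, Units.inv_mul, add_sub_cancel_left]
    exact congr(((($this : E →L[𝕜] E)) : E →ₗ[𝕜] E).HasFiniteRange).mpr
      (LinearMap.HasFiniteRange.comp_left hR₁ _)
  have hR : (W : E →ₗ[𝕜] E) ∘ₗ (R : E →ₗ[𝕜] E) ≈ .id := by
    rw [LinearMap.FiniteRangeSetoid.equiv_iff_hasFiniteRange]
    have : W * R - 1 = R₂ * ↑u₂⁻¹ := by
      rw [← mul_assoc, h₂, add_mul, Units.mul_inv, add_sub_cancel_left]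
    exact congr(((($this : E →L[𝕜] E)) : E →ₗ[𝕜] E).HasFiniteRange).mpr
      (LinearMap.HasFiniteRange.comp_right hR₂ _)
  -- A left and a right inverse modulo finite rank agree modulo finite rank.
  have hLR : (L : E →ₗ[𝕜] E) ≈ (R : E →ₗ[𝕜] E) := by
    have e₁ := LinearMap.FiniteRangeSetoid.equiv_comp_right (u := (R : E →ₗ[𝕜] E)) hL
    have e₂ := LinearMap.FiniteRangeSetoid.equiv_comp_left (u' := (L : E →ₗ[𝕜] E)) hR
    rw [LinearMap.comp_assoc] at e₁
    exact Setoid.trans (Setoid.symm e₂) e₁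
  refine ContinuousLinearMap.IsFredholm.of_isQuasiInverse (v := L) ⟨hL, ?_⟩
  exact Setoid.trans (LinearMap.FiniteRangeSetoid.equiv_comp_left (u' := (W : E →ₗ[𝕜] E)) hLR) hR

end FiniteRank

/-! ### Bordered operators -/

section Bordered

variable {𝕜 V K : Type*} [Field 𝕜] [AddCommGroup V] [Module 𝕜 V] [AddCommGroup K] [Module 𝕜 K]

/-- The operator `G` bordered by a subspace `K'` of its codomain and a map `π` on its domain:
the block matrix with rows `(G, inclusion of K')` and `(π, 0)`. -/
def bordered (G : V →ₗ[𝕜] V) (K' : Submodule 𝕜 V) (π : V →ₗ[𝕜] K) : V × K' →ₗ[𝕜] V × K :=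
  (G.coprod K'.subtype).prod (π ∘ₗ LinearMap.fst 𝕜 V K')

@[simp]
lemma bordered_apply (G : V →ₗ[𝕜] V) (K' : Submodule 𝕜 V) (π : V →ₗ[𝕜] K) (p : V × K') :
    bordered G K' π p = (G p.1 + p.2, π p.1) := by
  simp [bordered]

variable {G : V →ₗ[𝕜] V} {K' : Submodule 𝕜 V} {π : V →ₗ[𝕜] K}

/-- If the bordered operator is bijective, `π` identifies the preimage `G⁻¹(K')` with `K`. -/
def comapEquivOfBordered (h : Function.Bijective (bordered G K' π)) : K'.comap G ≃ₗ[𝕜] K :=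
  LinearEquiv.ofBijective (π.domRestrict (K'.comap G)) <| by
    constructor
    · rw [← LinearMap.ker_eq_bot, LinearMap.ker_eq_bot']
      rintro ⟨x, hx⟩ hx0
      have := @h.1 (x, -⟨G x, hx⟩) 0 (by simpa using hx0)
      simpa using congrArg Prod.fst this
    · intro k
      obtain ⟨⟨x, k'⟩, hx⟩ := h.2 (0, k)
      rw [bordered_apply, Prod.mk.injEq] at hx
      refine ⟨⟨x, ?_⟩, hx.2⟩
      rw [Submodule.mem_comap, eq_neg_of_add_eq_zero_left hx.1]
      exact K'.neg_mem k'.2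

/-- The alternating sum of dimensions in the exact sequence
`0 → ker G → G⁻¹(K') → K' → coker G → 0`. -/
theorem finrank_ker_add_of_bordered [FiniteDimensional 𝕜 K] [FiniteDimensional 𝕜 K']
    (h : Function.Bijective (bordered G K' π)) :
    Module.finrank 𝕜 G.ker + Module.finrank 𝕜 K' =
      Module.finrank 𝕜 (V ⧸ G.range) + Module.finrank 𝕜 K := by
  have : FiniteDimensional 𝕜 (K'.comap G) := (comapEquivOfBordered h).symm.finiteDimensional
  let g : K'.comap G →ₗ[𝕜] K' := G.restrict fun _ hx => hx
  have hker : Module.finrank 𝕜 g.ker = Module.finrank 𝕜 G.ker := by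
    have hle : G.ker ≤ K'.comap G := fun x hx => by
      rw [Submodule.mem_comap, LinearMap.mem_ker.1 hx]; exact K'.zero_mem
    have : g.ker = G.ker.comap (K'.comap G).subtype := by
      ext x; simp [g, LinearMap.restrict_apply, Subtype.ext_iff]
    rw [this]
    exact (Submodule.comapSubtypeEquivOfLe hle).finrank_eq
  have hcoker : Module.finrank 𝕜 (K' ⧸ g.range) = Module.finrank 𝕜 (V ⧸ G.range) := by
    let q : K' →ₗ[𝕜] V ⧸ G.range := G.range.mkQ ∘ₗ K'.subtype
    have hq : q.ker = g.range := by
      ext k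
      simp only [q, LinearMap.mem_ker, LinearMap.comp_apply, Submodule.mkQ_apply,
        Submodule.Quotient.mk_eq_zero, LinearMap.mem_range, Submodule.subtype_apply]
      constructor
      · rintro ⟨x, hx⟩
        exact ⟨⟨x, by simp [hx]⟩, Subtype.ext hx⟩
      · rintro ⟨x, rfl⟩
        exact ⟨x, rfl⟩
    have hq' : Function.Surjective q := by
      intro y
      obtain ⟨v, rfl⟩ := G.range.mkQ_surjective y
      obtain ⟨⟨x, k'⟩, hx⟩ := h.2 (v, 0)
      rw [bordered_apply, Prod.mk.injEq] at hx
      refine ⟨k', ?_⟩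
      simp only [q, LinearMap.comp_apply, Submodule.mkQ_apply, Submodule.subtype_apply,
        Submodule.Quotient.eq]
      exact ⟨-x, by rw [map_neg, ← hx.1]; abel⟩
    rw [← hq]
    exact (q.quotKerEquivOfSurjective hq').finrank_eq
  have h₁ := g.finrank_range_add_finrank_ker
  have h₂ := g.range.finrank_quotient_add_finrank
  rw [(comapEquivOfBordered h).finrank_eq] at h₁
  omega

end Bordered

/-! ### Antisymmetric forms have even rank -/

section AntisymmetricForm

variable {𝕜 V : Type*} [Field 𝕜] [CharZero 𝕜] [AddCommGroup V] [Module 𝕜 V]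
  [FiniteDimensional 𝕜 V]

/-- A space carrying a nondegenerate antisymmetric form has even dimension: the Gram matrix
satisfies `det M = det Mᵀ = (-1)ⁿ det M`. -/
lemma even_finrank_of_nondegenerate {B : LinearMap.BilinForm 𝕜 V}
    (hB : ∀ x y, B x y = -B y x) (hn : B.Nondegenerate) : Even (Module.finrank 𝕜 V) := by
  let b := Module.finBasis 𝕜 V
  have hdet := (LinearMap.BilinForm.nondegenerate_iff_det_ne_zero b).1 hn
  have hT : (LinearMap.BilinForm.toMatrix b B).transpose = -LinearMap.BilinForm.toMatrix b B := by
    ext i j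
    simp [LinearMap.BilinForm.toMatrix_apply, hB (b j) (b i)]
  have h := congrArg Matrix.det hT
  rw [Matrix.det_transpose, Matrix.det_neg, Fintype.card_fin] at h
  by_contra hodd
  rw [Nat.not_even_iff_odd] at hodd
  rw [hodd.neg_one_pow, neg_one_mul] at h
  exact hdet (self_eq_neg.1 h)

/-- The rank of an antisymmetric form is even. -/
theorem even_finrank_sub_finrank_ker {B : LinearMap.BilinForm 𝕜 V}
    (hB : ∀ x y, B x y = -B y x) :
    Even (Module.finrank 𝕜 V - Module.finrank 𝕜 (LinearMap.ker B)) := by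
  obtain ⟨C, hC⟩ := Submodule.exists_isCompl (LinearMap.ker B)
  have hrank := Submodule.finrank_add_eq_of_isCompl hC
  rw [← hrank, Nat.add_sub_cancel_left]
  refine even_finrank_of_nondegenerate (B := B.restrict C) (fun x y => hB x y) ?_
  have hrefl : B.IsRefl := fun x y h => by rw [hB, h, neg_zero]
  refine LinearMap.BilinForm.nondegenerate_restrict_of_disjoint_orthogonal B hrefl ?_
  rw [Submodule.disjoint_def]
  intro y hyC hy
  -- A vector of `C` orthogonal to `C` is orthogonal to everything, as `V = ker B ⊕ C`.
  refine (Submodule.disjoint_def.1 hC.disjoint) y ?_ hyC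
  rw [LinearMap.mem_ker]
  ext z
  obtain ⟨k, hk, c, hc, rfl⟩ := Submodule.mem_sup.1 (hC.sup_eq_top ▸ Submodule.mem_top (x := z))
  have hyc : B c y = 0 := hy c hc
  have hyk : B k y = 0 := by rw [LinearMap.mem_ker.1 hk, LinearMap.zero_apply]
  rw [hB, map_add, LinearMap.add_apply, hyc, hyk]
  simp

end AntisymmetricForm

/-! ### Local constancy of the index and of the parity of the kernel -/

section Stability

open ContinuousLinearMap Filter Topology

variable {H : Type*} [NormedAddCommGroup H] [InnerProductSpace ℂ H] [CompleteSpace H]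

lemma finrank_ker_adjoint {F : H →L[ℂ] H} (hF : F.IsFredholm) :
    Module.finrank ℂ (adjoint F).ker = Module.finrank ℂ (H ⧸ F.range) := by
  have : CompleteSpace F.range := hF.isClosed_range.completeSpace_coe
  rw [← ContinuousLinearMap.orthogonal_range]
  exact (Submodule.quotientEquivOfIsCompl _ _
    (Submodule.isCompl_orthogonal (K := F.range))).finrank_eq.symm

lemma finiteDimensional_ker_adjoint {F : H →L[ℂ] H} (hF : F.IsFredholm) :
    FiniteDimensional ℂ (adjoint F).ker := by
  have : CompleteSpace F.range := hF.isClosed_range.completeSpace_coe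
  have : FiniteDimensional ℂ (H ⧸ F.range) := hF.finite_coker
  rw [← ContinuousLinearMap.orthogonal_range]
  exact (Submodule.quotientEquivOfIsCompl _ _
    (Submodule.isCompl_orthogonal (K := F.range))).finiteDimensional

/-- The operator `G` bordered by `ker F*` and by the orthogonal projection onto `ker F`, as a
continuous map. -/
def borderedCLM (F : H →L[ℂ] H) [F.ker.HasOrthogonalProjection] (G : H →L[ℂ] H) :
    (H × (adjoint F).ker) →L[ℂ] (H × F.ker) :=
  (G.coprod (adjoint F).ker.subtypeL).prod
    (F.ker.orthogonalProjectionOnto ∘L ContinuousLinearMap.fst ℂ H (adjoint F).ker)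

lemma continuous_borderedCLM (F : H →L[ℂ] H) [F.ker.HasOrthogonalProjection] :
    Continuous (borderedCLM F) := by
  have : borderedCLM F = fun G => borderedCLM F 0 +
      (ContinuousLinearMap.inl ℂ H F.ker ∘L G) ∘L ContinuousLinearMap.fst ℂ H (adjoint F).ker := by
    funext G
    ext p <;> simp [borderedCLM]
  rw [this]
  fun_prop

/-- The bordered Fredholm operator is invertible since `H = ran F ⊕ ker F*`. -/
lemma bijective_borderedCLM_self {F : H →L[ℂ] H} [F.ker.HasOrthogonalProjection]
    (hF : F.IsFredholm) : Function.Bijective (borderedCLM F F) := by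
  have : CompleteSpace F.range := hF.isClosed_range.completeSpace_coe
  have horth : ∀ (x : H) (k : (adjoint F).ker), inner ℂ (F x) (k : H) = 0 := fun x k => by
    have hk : adjoint F k = 0 := k.2
    rw [← ContinuousLinearMap.adjoint_inner_right, hk, inner_zero_right]
  constructor
  · refine (injective_iff_map_eq_zero _).2 ?_
    rintro ⟨x, k⟩ h
    simp only [borderedCLM, ContinuousLinearMap.prod_apply, ContinuousLinearMap.coprod_apply,
      Prod.mk_eq_zero, ContinuousLinearMap.comp_apply, ContinuousLinearMap.coe_fst',
      Submodule.subtypeL_apply] at h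
    have hk : (k : H) = 0 := by
      have h0 : inner ℂ (F x + k) (k : H) = 0 := by rw [h.1, inner_zero_left]
      rwa [inner_add_left, horth, zero_add, inner_self_eq_zero] at h0
    have hx : x ∈ F.ker := by
      have := h.1
      rwa [hk, add_zero] at this
    have hx0 := h.2
    rw [Submodule.orthogonalProjectionOnto_eq_zero_iff] at hx0
    have := hx0 x hx
    rw [inner_self_eq_zero] at this
    exact Prod.ext this (Subtype.ext hk)
  · rintro ⟨v, κ⟩
    have hv : v ∈ F.range ⊔ (adjoint F).ker := by
      rw [← ContinuousLinearMap.orthogonal_range, Submodule.sup_orthogonal_of_hasOrthogonalProjection]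
      trivial
    obtain ⟨_, ⟨x, rfl⟩, k, hk, rfl⟩ := Submodule.mem_sup.1 hv
    refine ⟨(x - F.ker.orthogonalProjectionOnto x + κ, ⟨k, hk⟩), ?_⟩
    have e₁ : F (F.ker.orthogonalProjectionOnto x) = 0 := (F.ker.orthogonalProjectionOnto x).2
    have e₂ : F κ = 0 := κ.2
    refine Prod.ext ?_ ?_
    · simp only [borderedCLM, ContinuousLinearMap.prod_apply, ContinuousLinearMap.coprod_apply,
        Submodule.subtypeL_apply, map_add, map_sub, e₁, e₂, sub_zero, add_zero]
      rfl
    · simp only [borderedCLM, ContinuousLinearMap.prod_apply, ContinuousLinearMap.comp_apply,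
        ContinuousLinearMap.coe_fst', map_add, map_sub,
        Submodule.orthogonalProjectionOnto_mem_subspace_eq_self, sub_self, zero_add]

/-- Invertibility is an open condition, so it persists when `F` is replaced by a nearby `G` while
the border is kept fixed. -/
lemma eventually_bijective_bordered {F : H →L[ℂ] H} [F.ker.HasOrthogonalProjection]
    (hF : F.IsFredholm) :
    ∀ᶠ G : H →L[ℂ] H in 𝓝 F, Function.Bijective
      (bordered (G : H →ₗ[ℂ] H) (adjoint F).ker (F.ker.orthogonalProjectionOnto : H →ₗ[ℂ] F.ker)) := by
  have := finiteDimensional_ker_adjoint hF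
  have := hF.finite_ker
  let e : (H × (adjoint F).ker) ≃L[ℂ] (H × F.ker) :=
    ContinuousLinearEquiv.ofBijective (borderedCLM F F)
      (LinearMap.ker_eq_bot.2 (bijective_borderedCLM_self hF).1)
      (LinearMap.range_eq_top.2 (bijective_borderedCLM_self hF).2)
  have he : Set.range ((↑) : ((H × (adjoint F).ker) ≃L[ℂ] (H × F.ker)) → _) ∈
      𝓝 (borderedCLM F F) := ContinuousLinearEquiv.nhds e
  filter_upwards [(continuous_borderedCLM F).continuousAt he]
  rintro G ⟨e', he'⟩
  exact congrArg (fun T : (H × (adjoint F).ker) →L[ℂ] (H × F.ker) => Function.Bijective T) he' ▸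
    e'.bijective

/-- The Fredholm index is locally constant on the set of Fredholm operators. -/
theorem eventually_index_eq {F : H →L[ℂ] H} (hF : F.IsFredholm) :
    ∀ᶠ G : H →L[ℂ] H in 𝓝 F, G.IsFredholm →
      (Module.finrank ℂ G.ker : ℤ) - Module.finrank ℂ (adjoint G).ker =
        (Module.finrank ℂ F.ker : ℤ) - Module.finrank ℂ (adjoint F).ker := by
  have := finiteDimensional_ker_adjoint hF
  have := hF.finite_ker
  filter_upwards [eventually_bijective_bordered hF] with G hb hG
  have h := finrank_ker_add_of_bordered hb
  rw [finrank_ker_adjoint hG]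
  change Module.finrank ℂ G.ker + _ = Module.finrank ℂ (H ⧸ G.range) + _ at h
  omega

variable {Θ : H →ₛₗ[starRingEnd ℂ] H}

/-- The form `(φ, ψ) ↦ ⟨Θφ, Gψ⟩` on a subspace; it is bilinear as `Θ` is conjugate-linear. -/
def thetaForm (Θ : H →ₛₗ[starRingEnd ℂ] H) (G : H →L[ℂ] H) (X : Submodule ℂ H) :
    LinearMap.BilinForm ℂ X :=
  LinearMap.mk₂ ℂ (fun φ ψ => inner ℂ (Θ φ) (G ψ))
    (fun _ _ _ => by simp) (fun _ _ _ => by simp [mul_comm])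
    (fun _ _ _ => by simp) (fun _ _ _ => by simp)

/-- If `G` is `Θ`-odd, the form `⟨Θφ, Gψ⟩` is antisymmetric. -/
lemma inner_theta_antisymm (hΘ : ∀ ψ φ, inner ℂ (Θ ψ) (Θ φ) = inner ℂ φ ψ) {G : H →L[ℂ] H}
    (hG : ∀ ψ, G ψ = -Θ (adjoint G (Θ ψ))) (φ ψ : H) :
    inner ℂ (Θ φ) (G ψ) = -inner ℂ (Θ ψ) (G φ) := by
  rw [hG ψ, inner_neg_right, hΘ, ContinuousLinearMap.adjoint_inner_left]

/-- The parity of `dim ker F` is locally constant on the set of Fredholm operators `F` with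
`F = -Θ F* Θ`. For `G` near `F` the space `X = G⁻¹(ker F*)` has the dimension of `ker F`, and
`ker G` is the kernel of the antisymmetric form `⟨Θφ, Gψ⟩` on `X`, whose rank is even. -/
theorem eventually_finrank_ker_parity_eq (hΘ : ∀ ψ φ, inner ℂ (Θ ψ) (Θ φ) = inner ℂ φ ψ)
    (hΘ2 : ∀ ψ, Θ (Θ ψ) = -ψ) {F : H →L[ℂ] H} (hF : F.IsFredholm)
    (hFo : ∀ ψ, F ψ = -Θ (adjoint F (Θ ψ))) :
    ∀ᶠ G : H →L[ℂ] H in 𝓝 F, (∀ ψ, G ψ = -Θ (adjoint G (Θ ψ))) →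
      (Module.finrank ℂ G.ker : ZMod 2) = Module.finrank ℂ F.ker := by
  have := finiteDimensional_ker_adjoint hF
  have := hF.finite_ker
  filter_upwards [eventually_bijective_bordered hF] with G hb hGo
  set X : Submodule ℂ H := (adjoint F).ker.comap (G : H →ₗ[ℂ] H) with hX
  have hfin : FiniteDimensional ℂ X := (comapEquivOfBordered hb).symm.finiteDimensional
  have hdim : Module.finrank ℂ X = Module.finrank ℂ F.ker := (comapEquivOfBordered hb).finrank_eq
  have hle : G.ker ≤ X := fun x hx => by
    have : G x = 0 := hx
    simp [hX, this]
  have hker : LinearMap.ker (thetaForm Θ G X) = G.ker.comap X.subtype := by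
    ext ψ
    rw [LinearMap.mem_ker, Submodule.mem_comap, LinearMap.mem_ker]
    constructor
    · intro h
      have hψX : ∀ φ : X, inner ℂ (Θ φ) (G ψ) = 0 := fun φ => by
        rw [inner_theta_antisymm hΘ hGo]
        exact neg_eq_zero.2 (LinearMap.congr_fun h φ)
      -- As `Gψ ∈ ker F*` and `Θ` maps `ker F*` into `ker F`, the form vanishes on `(ker F)ᗮ` as well.
      have hψ : ∀ φ ∈ F.kerᗮ, inner ℂ (Θ φ) (G ψ) = 0 := fun φ hφ => by
        have hmem : Θ (G ψ) ∈ F.ker := by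
          have : adjoint F (G ψ) = 0 := ψ.2
          change F (Θ (G ψ)) = 0
          rw [hFo, hΘ2, map_neg, this]
          simp
        have h0 := hφ _ hmem
        rw [← neg_neg φ, ← hΘ2, map_neg, hΘ, inner_neg_left] at h0
        exact neg_eq_zero.1 h0
      -- `H` is spanned by `X` and the orthogonal complement of `ker F`.
      have hall : ∀ φ, inner ℂ (Θ φ) (G ψ) = 0 := fun φ => by
        let x : X := (comapEquivOfBordered hb).symm (F.ker.orthogonalProjectionOnto φ)
        have hx : F.ker.orthogonalProjectionOnto (x : H) = F.ker.orthogonalProjectionOnto φ :=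
          (comapEquivOfBordered hb).apply_symm_apply _
        have hperp : φ - x ∈ F.kerᗮ := by
          rw [← Submodule.orthogonalProjectionOnto_eq_zero_iff, map_sub, hx, sub_self]
        rw [← sub_add_cancel φ (x : H), map_add, inner_add_left, hψ _ hperp, hψX, add_zero]
      have h0 := hall (-Θ (G ψ))
      rw [map_neg, hΘ2, neg_neg, inner_self_eq_zero] at h0
      exact h0
    · intro h
      have h' : G ψ = 0 := h
      ext φ
      change inner ℂ (Θ ψ) (G φ) = 0
      rw [inner_theta_antisymm hΘ hGo, h', inner_zero_right, neg_zero]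
  have hev := even_finrank_sub_finrank_ker (B := thetaForm Θ G X)
    (fun φ ψ => inner_theta_antisymm hΘ hGo φ ψ)
  rw [hker, (Submodule.comapSubtypeEquivOfLe hle).finrank_eq, hdim] at hev
  have hle' : Module.finrank ℂ G.ker ≤ Module.finrank ℂ F.ker :=
    hdim ▸ Submodule.finrank_mono hle
  obtain ⟨m, hm⟩ := hev
  have : Module.finrank ℂ F.ker = Module.finrank ℂ G.ker + 2 * m := by omega
  rw [this]
  push_cast
  rw [show (2 : ZMod 2) = 0 from rfl, zero_mul, add_zero]

end Stability

variable {S : Set (ℤ × ℤ)} {N : ℕ}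

/-! ### Block kernels with summable decay -/

lemma block_apply (A : Op S N) (x y : S) (v : EuclideanSpace ℂ (Fin N)) :
    block A x y v = A (lp.single 2 y v) x := rfl

lemma norm_apply_single_le {T : Op S N} {y : S} {g : S → ℝ} (hg : Summable g)
    (h : ∀ x, ‖block T x y‖ ≤ g x) (v : EuclideanSpace ℂ (Fin N)) :
    ‖T (lp.single 2 y v)‖ ≤ (∑' x, g x) * ‖v‖ := by
  refine (lp.hasSum_single ENNReal.ofNat_ne_top (T (lp.single 2 y v))).norm_le_of_bounded
    (hg.hasSum.mul_right ‖v‖) fun x => ?_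
  rw [lp.norm_single (by norm_num)]
  exact ((block T x y).le_opNorm v).trans (by gcongr; exact h x)

/-- An operator with a summable block kernel is the norm-convergent sum of its restrictions to
the single sites, which are of finite rank. -/
theorem mem_approxFiniteRank_of_norm_block_le {T : Op S N} {w : S → ℝ} (hw : Summable w)
    (h : ∀ x y, ‖block T x y‖ ≤ w x * w y) : T ∈ approxFiniteRank ℂ (Space S N) := by
  let P : S → Op S N := fun y =>
    lp.singleContinuousLinearMap ℂ (fun _ : S => EuclideanSpace ℂ (Fin N)) 2 y ∘L
      lp.evalCLM ℂ (fun _ : S => EuclideanSpace ℂ (Fin N)) 2 y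
  have hP : ∀ y ψ, (T * P y) ψ = T (lp.single 2 y (ψ y)) := fun _ _ => rfl
  have hfin : ∀ y, T * P y ∈ approxFiniteRank ℂ (Space S N) := fun y =>
    mem_approxFiniteRank_of_hasFiniteRange <|
      LinearMap.HasFiniteRange.comp_right (LinearMap.HasFiniteRange.of_finite_dom
        (f := ((T ∘L lp.singleContinuousLinearMap ℂ (fun _ : S => EuclideanSpace ℂ (Fin N)) 2 y :
          EuclideanSpace ℂ (Fin N) →L[ℂ] Space S N) : EuclideanSpace ℂ (Fin N) →ₗ[ℂ] Space S N)))
        ((lp.evalCLM ℂ (fun _ : S => EuclideanSpace ℂ (Fin N)) 2 y :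
          Space S N →L[ℂ] EuclideanSpace ℂ (Fin N)) : Space S N →ₗ[ℂ] EuclideanSpace ℂ (Fin N))
  have hnorm : ∀ y, ‖T * P y‖ ≤ |∑' x, w x| * |w y| := fun y => by
    refine ContinuousLinearMap.opNorm_le_bound _ (by positivity) fun ψ => ?_
    rw [hP, ← abs_mul, ← tsum_mul_right]
    refine (norm_apply_single_le (hw.mul_right (w y)) (fun x => h x y) _).trans ?_
    exact mul_le_mul (le_abs_self _) (lp.norm_apply_le_norm two_ne_zero ψ y) (norm_nonneg _)
      (abs_nonneg _)
  have hsum : Summable fun y => T * P y :=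
    Summable.of_norm_bounded (hw.abs.mul_left _) hnorm
  have hT : HasSum (fun y => T * P y) T := by
    convert hsum.hasSum
    ext1 ψ
    have h₁ := (lp.hasSum_single ENNReal.ofNat_ne_top ψ).mapL T
    have h₂ := hsum.hasSum.mapL (ContinuousLinearMap.apply ℂ (Space S N) ψ)
    exact h₁.unique h₂
  exact isClosed_approxFiniteRank.mem_of_tendsto hT
    (Filter.Eventually.of_forall fun s => Submodule.sum_mem _ fun y _ => hfin y)

lemma summable_inv_one_add_abs_sq : Summable fun n : ℤ => ((1 + |(n : ℝ)|) ^ 2)⁻¹ := by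
  have h : Summable fun n : ℕ => ((1 + (n : ℝ)) ^ 2)⁻¹ := by
    refine ((summable_nat_add_iff 1).2 (Real.summable_one_div_nat_pow.2 one_lt_two)).congr ?_
    intro n
    push_cast
    rw [one_div, add_comm]
  exact Summable.of_nat_of_neg (by simpa using h) (by simpa using h)

lemma abs_fst_le_norm (x : ℤ × ℤ) : |(x.1 : ℝ)| ≤ ‖x‖ := by
  rw [← Int.norm_eq_abs]; exact norm_fst_le x

lemma abs_snd_le_norm (x : ℤ × ℤ) : |(x.2 : ℝ)| ≤ ‖x‖ := by
  rw [← Int.norm_eq_abs]; exact norm_snd_le x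

lemma norm_le_iff_abs (x : ℤ × ℤ) (r : ℝ) : ‖x‖ ≤ r ↔ |(x.1 : ℝ)| ≤ r ∧ |(x.2 : ℝ)| ≤ r := by
  rw [Prod.norm_def, max_le_iff, Int.norm_eq_abs, Int.norm_eq_abs]

lemma summable_inv_one_add_norm_pow_four :
    Summable fun x : ℤ × ℤ => ((1 + ‖x‖) ^ 4)⁻¹ := by
  refine Summable.of_nonneg_of_le (fun x => by positivity) (fun x => ?_)
    (summable_inv_one_add_abs_sq.mul_of_nonneg summable_inv_one_add_abs_sq
      (fun _ => by positivity) (fun _ => by positivity))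
  rw [← mul_inv, show 4 = 2 + 2 from rfl, pow_add]
  gcongr
  · exact abs_fst_le_norm x
  · exact abs_snd_le_norm x

/-- If the block kernel is bounded by `c⁻ᵘ (1 + ‖x‖)ᵛ`, where `c = c(x, y)` controls the distance
of both sites to the origin polynomially and `u` is large compared with `v`, then the decay in `c`
absorbs the growth and leaves a summable kernel. -/
lemma mem_approxFiniteRank_of_decay {T : Op S N} {ν μ : ℕ} (hμ : 2 * ν + 16 ≤ μ) {C : ℝ}
    (h : ∀ x y, block T x y ≠ 0 → ∃ c : ℝ, 1 ≤ c ∧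
      ‖block T x y‖ ≤ C * (c ^ μ)⁻¹ * (1 + ‖(x : ℤ × ℤ)‖) ^ ν ∧
      1 + ‖(x : ℤ × ℤ)‖ ≤ c ^ 2 ∧ 1 + ‖(y : ℤ × ℤ)‖ ≤ c ^ 2) :
    T ∈ approxFiniteRank ℂ (Space S N) := by
  refine mem_approxFiniteRank_of_norm_block_le
    (w := fun x => √|C| * ((1 + ‖(x : ℤ × ℤ)‖) ^ 4)⁻¹)
    ((summable_inv_one_add_norm_pow_four.comp_injective Subtype.val_injective).mul_left _)
    fun x y => ?_
  rw [mul_mul_mul_comm, Real.mul_self_sqrt (abs_nonneg C), ← mul_inv]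
  by_cases h0 : block T x y = 0
  · rw [h0, norm_zero]; positivity
  obtain ⟨c, hc, hb, hx, hy⟩ := h x y h0
  refine hb.trans ?_
  rw [mul_assoc]
  refine mul_le_mul (le_abs_self C) ?_ (by positivity) (abs_nonneg C)
  set X := 1 + ‖(x : ℤ × ℤ)‖
  set Y := 1 + ‖(y : ℤ × ℤ)‖
  have hX : 0 < X := by positivity
  have hY : 0 < Y := by positivity
  rw [inv_mul_le_iff₀ (by positivity), ← div_eq_mul_inv, le_div_iff₀ (by positivity)]
  calc X ^ ν * (X ^ 4 * Y ^ 4) ≤ (c ^ 2) ^ ν * ((c ^ 2) ^ 4 * (c ^ 2) ^ 4) := by gcongr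
    _ = c ^ (2 * ν + 16) := by ring
    _ ≤ c ^ μ := pow_le_pow_right₀ hc hμ

/-! ### Restriction to a set of sites, and commutators with a half-space projection -/

/-- The orthogonal projection onto the functions supported in `P`. -/
def siteProj (P : Set (ℤ × ℤ)) : Op S N :=
  LinearMap.mkContinuous
    { toFun := fun ψ => ⟨(Subtype.val ⁻¹' P : Set S).indicator ψ,
        (lp.memℓp ψ).mono' fun _ => norm_indicator_le_norm_self _ _⟩
      map_add' := fun ψ φ => by
        ext1
        exact Set.indicator_add _ _ _
      map_smul' := fun c ψ => by
        ext1
        exact Set.indicator_const_smul (Subtype.val ⁻¹' P : Set S) c (ψ : ∀ _, _) }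
    1 (fun ψ => by
      rw [one_mul]
      exact lp.norm_mono (by norm_num) fun _ => norm_indicator_le_norm_self _ _)

open scoped Classical in
lemma siteProj_apply (P : Set (ℤ × ℤ)) (ψ : Space S N) (x : S) :
    siteProj P ψ x = if (x : ℤ × ℤ) ∈ P then ψ x else 0 := by
  change (Subtype.val ⁻¹' P : Set S).indicator ψ x = _
  rw [Set.indicator_apply]
  rfl

lemma halfSpaceProj_eq_siteProj (j : Direction) :
    (halfSpaceProj j : Op S N) = siteProj {x | 0 ≤ coord j x} := by
  ext1 ψ; ext1; funext x
  rw [siteProj_apply]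
  change cutoff j ψ x = _
  unfold cutoff
  congr

lemma siteProj_compl (P : Set (ℤ × ℤ)) : (siteProj Pᶜ : Op S N) = 1 - siteProj P := by
  ext1 ψ; ext1; funext x
  rw [sub_apply, lp.coeFn_sub, Pi.sub_apply]
  by_cases hx : (x : ℤ × ℤ) ∈ P <;> simp [siteProj_apply, hx]

lemma siteProj_mul_self (P : Set (ℤ × ℤ)) : (siteProj P : Op S N) * siteProj P = siteProj P := by
  ext1 ψ; ext1; funext x
  rw [mul_apply_eq_comp]
  by_cases hx : (x : ℤ × ℤ) ∈ P <;> simp [siteProj_apply, hx]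

open scoped Classical in
lemma siteProj_single (P : Set (ℤ × ℤ)) (y : S) (v : EuclideanSpace ℂ (Fin N)) :
    (siteProj P : Op S N) (lp.single 2 y v) =
      if (y : ℤ × ℤ) ∈ P then lp.single 2 y v else 0 := by
  ext1; funext x
  rw [siteProj_apply]
  by_cases hxy : x = y
  · subst hxy
    split_ifs <;> rfl
  · have : (lp.single 2 y v : Space S N) x = 0 := by
      rw [lp.single_apply, Pi.single_eq_of_ne hxy]
    split_ifs
    · rfl
    · exact this
    · exact this.symm
    · rfl

lemma isSelfAdjoint_siteProj (P : Set (ℤ × ℤ)) : IsSelfAdjoint (siteProj P : Op S N) := by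
  rw [ContinuousLinearMap.isSelfAdjoint_iff_isSymmetric]
  intro ψ φ
  rw [lp.inner_eq_tsum, lp.inner_eq_tsum]
  congr 1; funext x
  change inner ℂ (siteProj P ψ x) (φ x) = inner ℂ (ψ x) (siteProj P φ x)
  by_cases hx : (x : ℤ × ℤ) ∈ P <;> simp [siteProj_apply, hx]

lemma block_sub (A B : Op S N) (x y : S) : block (A - B) x y = block A x y - block B x y := by
  ext1 v
  simp only [block_apply, sub_apply, lp.coeFn_sub, Pi.sub_apply]

open scoped Classical in
lemma block_siteProj_mul (P : Set (ℤ × ℤ)) (T : Op S N) (x y : S) :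
    block (siteProj P * T) x y = if (x : ℤ × ℤ) ∈ P then block T x y else 0 := by
  ext1 v
  rw [block_apply, mul_apply_eq_comp, siteProj_apply]
  split_ifs <;> rfl

open scoped Classical in
lemma block_mul_siteProj (P : Set (ℤ × ℤ)) (T : Op S N) (x y : S) :
    block (T * siteProj P) x y = if (y : ℤ × ℤ) ∈ P then block T x y else 0 := by
  ext1 v
  rw [block_apply, mul_apply_eq_comp, siteProj_single]
  split_ifs
  · rfl
  · rw [map_zero]; rfl

/-- A commutator with the half-space projection only connects sites on different sides of the
line `x₁ = 0`, so that their distance bounds `|x₁|`. -/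
lemma block_commutator_halfSpaceProj (B : Op S N) {x y : S}
    (h : block (halfSpaceProj .first * B - B * halfSpaceProj .first) x y ≠ 0) :
    ‖block (halfSpaceProj .first * B - B * halfSpaceProj .first) x y‖ = ‖block B x y‖ ∧
      |((x : ℤ × ℤ).1 : ℝ)| ≤ ‖(x : ℤ × ℤ) - y‖ := by
  have hsub : |((x : ℤ × ℤ).1 : ℝ) - (y : ℤ × ℤ).1| ≤ ‖(x : ℤ × ℤ) - y‖ := by
    have := abs_fst_le_norm ((x : ℤ × ℤ) - y)
    push_cast [Prod.fst_sub] at this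
    exact this
  rw [halfSpaceProj_eq_siteProj, block_sub, block_siteProj_mul, block_mul_siteProj] at h ⊢
  set P : Set (ℤ × ℤ) := {x | 0 ≤ coord .first x}
  have hP : ∀ z : ℤ × ℤ, z ∈ P ↔ 0 ≤ (z.1 : ℝ) := fun z => by
    rw [Int.cast_nonneg_iff]; exact Iff.rfl
  by_cases hx : (x : ℤ × ℤ) ∈ P <;> by_cases hy : (y : ℤ × ℤ) ∈ P
  · simp [hx, hy] at h
  · refine ⟨by rw [if_pos hx, if_neg hy, sub_zero], le_trans ?_ hsub⟩
    rw [hP] at hx hy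
    rw [abs_of_nonneg hx]
    exact le_trans (by linarith) (le_abs_self _)
  · refine ⟨by rw [if_neg hx, if_pos hy, zero_sub, norm_neg], le_trans ?_ hsub⟩
    rw [hP] at hx hy
    rw [abs_of_nonpos (by linarith)]
    exact le_trans (by linarith) (neg_le_abs _)
  · simp [hx, hy] at h

lemma one_add_norm_le_mul (x y : ℤ × ℤ) : 1 + ‖y‖ ≤ (1 + ‖x‖) * (1 + ‖x - y‖) := by
  have := norm_sub_le x (x - y)
  rw [sub_sub_cancel] at this
  nlinarith [norm_nonneg x, norm_nonneg (x - y), mul_nonneg (norm_nonneg x) (norm_nonneg (x - y))]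

lemma le_mul_sq_and_le_mul_sq {a b X Y : ℝ} (ha : 1 ≤ a) (hb : 1 ≤ b) (hX : X ≤ a * b)
    (hY : Y ≤ X * a) : 1 ≤ a * b ∧ X ≤ (a * b) ^ 2 ∧ Y ≤ (a * b) ^ 2 := by
  have hab : a ≤ a * b := le_mul_of_one_le_right (by linarith) hb
  have hc : 1 ≤ a * b := ha.trans hab
  refine ⟨hc, by nlinarith, hY.trans ?_⟩
  rw [sq]
  exact (mul_le_mul_of_nonneg_right hX (by linarith)).trans
    (mul_le_mul_of_nonneg_left hab (by linarith))

/-- If `Q` is confined in direction `2`, its commutator with `Λ₁` is concentrated near the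
origin. -/
lemma commutator_mem_of_isConfined {Q : Op S N} (hQ : IsConfined .second Q) :
    halfSpaceProj .first * Q - Q * halfSpaceProj .first ∈ approxFiniteRank ℂ (Space S N) := by
  obtain ⟨ν, -, h⟩ := hQ
  obtain ⟨μ, ⟨C, hC⟩, hμ⟩ := (h.and (Filter.eventually_ge_atTop (2 * ν + 16))).exists
  refine mem_approxFiniteRank_of_decay hμ (C := C) fun x y h0 => ?_
  obtain ⟨hn, hx⟩ := block_commutator_halfSpaceProj Q h0
  have ha := norm_nonneg ((x : ℤ × ℤ) - y)
  have hb := abs_nonneg ((x : ℤ × ℤ).2 : ℝ)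
  have hX : 1 + ‖(x : ℤ × ℤ)‖ ≤ (1 + ‖(x : ℤ × ℤ) - y‖) * (1 + |((x : ℤ × ℤ).2 : ℝ)|) := by
    have : ‖(x : ℤ × ℤ)‖ ≤ ‖(x : ℤ × ℤ) - y‖ + |((x : ℤ × ℤ).2 : ℝ)| :=
      (norm_le_iff_abs _ _).2 ⟨by linarith, by linarith⟩
    nlinarith
  obtain ⟨hc, hcX, hcY⟩ := le_mul_sq_and_le_mul_sq (by linarith) (by linarith) hX
    (one_add_norm_le_mul (x : ℤ × ℤ) y)
  refine ⟨_, hc, ?_, hcX, hcY⟩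
  rw [hn, mul_pow, mul_inv, ← mul_assoc]
  exact hC x y

/-- If `Q` is confined in direction `2`, it decays at infinity along the columns in the double cone
around the axis `x₁ = 0`. -/
lemma mul_siteProj_cone_mem {Q : Op S N} (hQ : IsConfined .second Q) :
    Q * siteProj {x | |x.1| ≤ |x.2|} ∈ approxFiniteRank ℂ (Space S N) := by
  obtain ⟨ν, -, h⟩ := hQ
  obtain ⟨μ, ⟨C, hC⟩, hμ⟩ := (h.and (Filter.eventually_ge_atTop (2 * ν + 16))).exists
  refine mem_approxFiniteRank_of_decay hμ (C := C) fun x y h0 => ?_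
  rw [block_mul_siteProj] at h0 ⊢
  split_ifs at h0 ⊢ with hy
  swap
  · exact absurd rfl h0
  have ha := norm_nonneg ((x : ℤ × ℤ) - y)
  have hb := abs_nonneg ((x : ℤ × ℤ).2 : ℝ)
  rw [Set.mem_ofPred_eq] at hy
  rify at hy
  have hyx : |((y : ℤ × ℤ).2 : ℝ)| ≤ |((x : ℤ × ℤ).2 : ℝ)| + ‖(x : ℤ × ℤ) - y‖ := by
    have h₁ := abs_snd_le_norm ((x : ℤ × ℤ) - y)
    rw [Prod.snd_sub, Int.cast_sub] at h₁
    have h₂ := abs_sub_abs_le_abs_sub ((y : ℤ × ℤ).2 : ℝ) (x : ℤ × ℤ).2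
    rw [abs_sub_comm] at h₂
    linarith
  have hY : 1 + ‖(y : ℤ × ℤ)‖ ≤ (1 + ‖(x : ℤ × ℤ) - y‖) * (1 + |((x : ℤ × ℤ).2 : ℝ)|) := by
    have : ‖(y : ℤ × ℤ)‖ ≤ |((y : ℤ × ℤ).2 : ℝ)| := (norm_le_iff_abs _ _).2 ⟨hy, le_rfl⟩
    nlinarith
  have hX := one_add_norm_le_mul (y : ℤ × ℤ) x
  rw [norm_sub_rev] at hX
  obtain ⟨hc, hcY, hcX⟩ := le_mul_sq_and_le_mul_sq (by linarith) (by linarith) hY hX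
  refine ⟨_, hc, ?_, hcX, hcY⟩
  rw [mul_pow, mul_inv, ← mul_assoc]
  exact hC x y

/-- The commutator of a weakly-local operator with `Λ₁` decays at infinity along the rows outside
the double cone around the axis `x₁ = 0`. -/
lemma siteProj_compl_cone_mul_commutator_mem {A : Op S N} (hA : IsWeaklyLocal A) :
    siteProj {x | |x.1| ≤ |x.2|}ᶜ * (halfSpaceProj .first * A - A * halfSpaceProj .first) ∈
      approxFiniteRank ℂ (Space S N) := by
  obtain ⟨ν, h⟩ := hA
  obtain ⟨μ, ⟨C, hC⟩, hμ⟩ := (h.and (Filter.eventually_ge_atTop (2 * ν + 16))).exists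
  refine mem_approxFiniteRank_of_decay hμ (C := C) fun x y h0 => ?_
  rw [block_siteProj_mul] at h0 ⊢
  split_ifs at h0 ⊢ with hx
  swap
  · exact absurd rfl h0
  obtain ⟨hn, hx₁⟩ := block_commutator_halfSpaceProj A h0
  have ha := norm_nonneg ((x : ℤ × ℤ) - y)
  rw [Set.mem_compl_iff, Set.mem_ofPred_eq, not_le] at hx
  rify at hx
  have hX : 1 + ‖(x : ℤ × ℤ)‖ ≤ (1 + ‖(x : ℤ × ℤ) - y‖) * 1 := by
    have : ‖(x : ℤ × ℤ)‖ ≤ ‖(x : ℤ × ℤ) - y‖ := (norm_le_iff_abs _ _).2 ⟨hx₁, by linarith⟩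
    linarith
  obtain ⟨hc, hcX, hcY⟩ := le_mul_sq_and_le_mul_sq (by linarith) le_rfl hX
    (one_add_norm_le_mul (x : ℤ × ℤ) y)
  refine ⟨_, hc, ?_, hcX, hcY⟩
  rw [hn, mul_one]
  exact hC x y

lemma mul_commutator_mem {A Q : Op S N} (hQ : IsConfined .second Q) (hA : IsWeaklyLocal A) :
    Q * (halfSpaceProj .first * A - A * halfSpaceProj .first) ∈ approxFiniteRank ℂ (Space S N) := by
  set R := halfSpaceProj .first * A - A * halfSpaceProj .first
  -- Insert `1 = D + (1 - D)`, with `D` the projection onto the cone.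
  have : Q * R = Q * siteProj {x | |x.1| ≤ |x.2|} * R + Q * (siteProj {x | |x.1| ≤ |x.2|}ᶜ * R) := by
    rw [siteProj_compl]; noncomm_ring
  rw [this]
  exact Submodule.add_mem _ (mul_mem_approxFiniteRank_right (mul_siteProj_cone_mem hQ) R)
    (mul_mem_approxFiniteRank_left (siteProj_compl_cone_mul_commutator_mem hA) Q)

/-! ### The Fredholm property of `W` -/

open Complex in
/-- The function `z ↦ exp(-2πiz) - 1` vanishes at the zeros `0` and `1` of `z² - z`, so that it is
a multiple of `z² - z` by an entire function. -/
lemma exists_continuous_exp_sub_one_eq :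
    ∃ g : ℂ → ℂ, Continuous g ∧ ∀ z, exp (-2 * Real.pi * I * z) - 1 = (z * z - z) * g z := by
  let f : ℂ → ℂ := fun z => exp (-2 * Real.pi * I * z) - 1
  have hf : Differentiable ℂ f := by fun_prop
  have hf0 : f 0 = 0 := by simp [f]
  have hf1 : f 1 = 0 := by
    simp only [f, mul_one]
    rw [show (-2 * Real.pi * I : ℂ) = -(2 * Real.pi * I) by ring, exp_neg, exp_two_pi_mul_I]
    simp
  have hg : Differentiable ℂ (dslope f 0) := by
    rw [← differentiableOn_univ, Complex.differentiableOn_dslope Filter.univ_mem]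
    exact hf.differentiableOn
  have hg' : Differentiable ℂ (dslope (dslope f 0) 1) := by
    rw [← differentiableOn_univ, Complex.differentiableOn_dslope Filter.univ_mem]
    exact hg.differentiableOn
  refine ⟨_, hg'.continuous, fun z => ?_⟩
  have h₁ : (z - 0) * dslope f 0 z = f z - f 0 := by
    simpa using sub_smul_dslope f 0 z
  have h₂ : (z - 1) * dslope (dslope f 0) 1 z = dslope f 0 z - dslope f 0 1 := by
    simpa using sub_smul_dslope (dslope f 0) 1 z
  have h₃ : dslope f 0 1 = 0 := by
    have : (1 - 0) * dslope f 0 1 = f 1 - f 0 := by simpa using sub_smul_dslope f 0 1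
    simpa [hf0, hf1] using this
  change f z = _
  rw [h₃, sub_zero] at h₂
  rw [hf0, sub_zero, sub_zero] at h₁
  rw [← h₁, ← h₂]
  ring

section Ideal

variable {H : Type*} [NormedAddCommGroup H] [InnerProductSpace ℂ H] [CompleteSpace H]

/-- For self-adjoint `A` and `Q` commuting with `A`, the operators `B` commuting with `Q` with
`Q[P, B]` in the closed ideal of norm limits of finite-rank operators form a closed algebra, by
`Q[P, BC] = Q[P, B]C + B Q[P, C]`. If it contains `A` it contains every function of `A`. -/
lemma mul_commutator_cfc_mem {A Q P : H →L[ℂ] H} (hA : IsSelfAdjoint A) (hQA : Commute Q A)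
    (h : Q * (P * A - A * P) ∈ approxFiniteRank ℂ H) (g : ℂ → ℂ) :
    Q * (P * cfc g A - cfc g A * P) ∈ approxFiniteRank ℂ H := by
  let s : Set (H →L[ℂ] H) := {B | Q * B = B * Q ∧ Q * (P * B - B * P) ∈ approxFiniteRank ℂ H}
  have hs : IsClosed s :=
    (isClosed_eq (continuous_const_mul Q) (continuous_mul_const Q)).inter
      (isClosed_approxFiniteRank.preimage (by fun_prop))
  suffices ∀ B ∈ StarAlgebra.elemental ℂ A, B ∈ s from (this _ (cfc_mem_elemental g A)).2
  intro B hB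
  induction hB using StarAlgebra.elemental.induction_on with
  | self => exact ⟨hQA, h⟩
  | star_self => rw [hA.star_eq]; exact ⟨hQA, h⟩
  | algebraMap r =>
    refine ⟨(Algebra.commutes r Q).symm, ?_⟩
    rw [Algebra.commutes r P, sub_self, mul_zero]
    exact Submodule.zero_mem _
  | add u hu v hv h₁ h₂ =>
    refine ⟨by rw [mul_add, add_mul, h₁.1, h₂.1], ?_⟩
    rw [show Q * (P * (u + v) - (u + v) * P) = Q * (P * u - u * P) + Q * (P * v - v * P) by
      noncomm_ring]
    exact Submodule.add_mem _ h₁.2 h₂.2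
  | mul u hu v hv h₁ h₂ =>
    refine ⟨by rw [← mul_assoc, h₁.1, mul_assoc, h₂.1, mul_assoc], ?_⟩
    have : Q * (P * (u * v) - u * v * P) =
        Q * (P * u - u * P) * v + u * (Q * (P * v - v * P)) := by
      rw [← mul_assoc u Q, ← h₁.1]
      noncomm_ring
    rw [this]
    exact Submodule.add_mem _ (mul_mem_approxFiniteRank_right h₁.2 v)
      (mul_mem_approxFiniteRank_left h₂.2 u)
  | closure t ht hB => exact hs.closure_subset_iff.2 hB ‹_›

/-- The commutator `[P, exp(-2πiA)] = [P, Q g(A)] = [P, Q] g(A) + Q [P, g(A)]`, with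
`Q = A² - A`, is a norm limit of finite-rank operators if `[P, Q]` and `Q [P, A]` are. -/
lemma commutator_exp_mem {A P : H →L[ℂ] H} (hA : IsSelfAdjoint A)
    (h₁ : P * (A * A - A) - (A * A - A) * P ∈ approxFiniteRank ℂ H)
    (h₂ : (A * A - A) * (P * A - A * P) ∈ approxFiniteRank ℂ H) :
    P * NormedSpace.exp ((-2 * (Real.pi : ℂ) * Complex.I) • A) -
      NormedSpace.exp ((-2 * (Real.pi : ℂ) * Complex.I) • A) * P ∈ approxFiniteRank ℂ H := by
  obtain ⟨g, hg, hfg⟩ := exists_continuous_exp_sub_one_eq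
  have hn : IsStarNormal A := hA.isStarNormal
  have hexp : NormedSpace.exp ((-2 * (Real.pi : ℂ) * Complex.I) • A) =
      1 + (A * A - A) * cfc g A := by
    have hn' : IsStarNormal ((-2 * (Real.pi : ℂ) * Complex.I) • A) := inferInstance
    rw [← CFC.complex_exp_eq_normedSpace_exp hn', ← cfc_comp_smul _ _ _ (by fun_prop)]
    have e : (fun z : ℂ => Complex.exp ((-2 * (Real.pi : ℂ) * Complex.I) • z)) =
        fun z => 1 + (z * z - z) * g z := by
      funext z
      rw [← hfg, smul_eq_mul]
      ring
    rw [e, cfc_const_add 1 _ A (by fun_prop), cfc_mul _ _ A (by fun_prop) (by fun_prop),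
      cfc_sub _ _ A (by fun_prop) (by fun_prop), cfc_mul _ _ A (by fun_prop) (by fun_prop),
      cfc_id' ℂ A, map_one]
  have hQA : Commute (A * A - A) A := by
    rw [Commute, SemiconjBy]; noncomm_ring
  have h₃ := mul_commutator_cfc_mem hA hQA h₂ g
  rw [hexp]
  have : P * (1 + (A * A - A) * cfc g A) - (1 + (A * A - A) * cfc g A) * P =
      (P * (A * A - A) - (A * A - A) * P) * cfc g A +
        (A * A - A) * (P * cfc g A - cfc g A * P) := by noncomm_ring
  rw [this]
  exact Submodule.add_mem _ (mul_mem_approxFiniteRank_right h₁ _) h₃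

/-- If `U` is invertible and `[P, U]` is a norm limit of finite-rank operators, then
`P U P + (1 - P)` is Fredholm, with parametrix `P U⁻¹ P + (1 - P)`. -/
lemma isFredholm_compress {P U V : H →L[ℂ] H} (hP : P * P = P) (hUV : U * V = 1) (hVU : V * U = 1)
    (h : P * U - U * P ∈ approxFiniteRank ℂ H) : (P * U * P + (1 - P)).IsFredholm := by
  have key : ∀ A B : H →L[ℂ] H, A * B = 1 →
      (P * A * P + (1 - P)) * (P * B * P + (1 - P)) - 1 = P * A * P * B * P - P * (A * B) * P := by
    intro A B hAB
    rw [hAB, mul_one, hP]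
    have e₁ : P * (1 - P) = 0 := by rw [mul_sub, hP, mul_one, sub_self]
    have e₂ : (1 - P) * P = 0 := by rw [sub_mul, hP, one_mul, sub_self]
    have e₃ : (1 - P) * (1 - P) = 1 - P := by rw [mul_sub, e₂, mul_one, sub_zero]
    calc _ = P * A * (P * P) * B * P + P * A * (P * (1 - P)) + ((1 - P) * P) * B * P
          + (1 - P) * (1 - P) - 1 := by noncomm_ring
      _ = _ := by rw [e₁, e₂, e₃, hP]; noncomm_ring
  refine isFredholm_of_mul_sub_one_mem (V := P * V * P + (1 - P)) ?_ ?_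
  · have : P * V * P * U * P - P * (V * U) * P = P * V * ((P * U - U * P) * P) := by
      rw [sub_mul, mul_assoc U P P, hP]; noncomm_ring
    rw [key V U hVU, this]
    exact mul_mem_approxFiniteRank_left (mul_mem_approxFiniteRank_right h _) _
  · have : P * U * P * V * P - P * (U * V) * P = -(P * (P * U - U * P) * (V * P)) := by
      rw [mul_sub, ← mul_assoc P P, hP]; noncomm_ring
    rw [key U V hUV, this]
    exact Submodule.neg_mem _ (mul_mem_approxFiniteRank_right (mul_mem_approxFiniteRank_left h _) _)

end Ideal

lemma halfSpaceProj_mul_self (j : Direction) :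
    (halfSpaceProj j : Op S N) * halfSpaceProj j = halfSpaceProj j := by
  rw [halfSpaceProj_eq_siteProj, siteProj_mul_self]

theorem isFredholm_W {A : Op S N} (hA : IsQuasiProjection .second A) :
    (W .first A).IsFredholm := by
  let +nondep : NormedAlgebra ℚ (Op S N) := .restrictScalars ℚ ℂ (Op S N)
  have : IsUnit (NormedSpace.exp ((-2 * (Real.pi : ℂ) * Complex.I) • A)) :=
    NormedSpace.isUnit_exp _
  obtain ⟨u, hu⟩ := this
  refine isFredholm_compress (V := ↑u⁻¹) (halfSpaceProj_mul_self _) ?_ ?_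
    (commutator_exp_mem hA.isSelfAdjoint (commutator_mem_of_isConfined hA.isConfined)
      (mul_commutator_mem hA.isConfined hA.isWeaklyLocal))
  · rw [← hu, Units.mul_inv]
  · rw [← hu, Units.inv_mul]

lemma continuous_W (j : Direction) : Continuous (W j : Op S N → Op S N) := by
  let +nondep : NormedAlgebra ℚ (Op S N) := .restrictScalars ℚ ℂ (Op S N)
  have : Continuous (NormedSpace.exp : Op S N → Op S N) := NormedSpace.exp_continuous
  unfold W compress
  fun_prop

/-! ### Time reversal -/

section TimeReversal

variable {Θ : Space S N →ₛₗ[starRingEnd ℂ] Space S N}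

lemma IsTimeReversal.norm_map (hΘ : IsTimeReversal Θ) (ψ : Space S N) : ‖Θ ψ‖ = ‖ψ‖ := by
  rw [@norm_eq_sqrt_re_inner ℂ, @norm_eq_sqrt_re_inner ℂ _ _ _ _ ψ, hΘ.inner_map]

lemma IsTimeReversal.continuous (hΘ : IsTimeReversal Θ) : Continuous Θ :=
  (AddMonoidHomClass.isometry_of_norm Θ hΘ.norm_map).continuous

/-- A time-reversal symmetry acts site by site: the vectors supported at a site are the joint
eigenvectors of the position operators, whose eigenvalues are real. -/
lemma IsTimeReversal.single_apply_of_ne (hΘ : IsTimeReversal Θ) {x y : S} (hxy : x ≠ y)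
    (v : EuclideanSpace ℂ (Fin N)) : Θ (lp.single 2 y v) x = 0 := by
  by_contra h
  have hj : ∀ j, coord j (y : ℤ × ℤ) = coord j x := fun j => by
    have h₁ := hΘ.map_position j (lp.single 2 y v) ((coord j (y : ℤ × ℤ) : ℂ) • lp.single 2 y v)
      (fun z => by
        rw [lp.coeFn_smul, Pi.smul_apply]
        by_cases hz : z = y
        · rw [hz]
        · rw [lp.single_apply, Pi.single_eq_of_ne hz, smul_zero, smul_zero]) x
    rw [LinearMap.map_smulₛₗ, lp.coeFn_smul, Pi.smul_apply, map_intCast] at h₁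
    exact_mod_cast smul_left_injective ℂ h h₁
  exact hxy (Subtype.ext (Prod.ext (hj .first) (hj .second))).symm

lemma IsTimeReversal.siteProj_comm (hΘ : IsTimeReversal Θ) (P : Set (ℤ × ℤ)) (ψ : Space S N) :
    siteProj P (Θ ψ) = Θ (siteProj P ψ) := by
  have hs := lp.hasSum_single ENNReal.ofNat_ne_top ψ
  have h₁ := (hs.map Θ hΘ.continuous).mapL (siteProj P)
  have h₂ := (hs.mapL (siteProj P)).map Θ hΘ.continuous
  refine h₁.unique (h₂.congr_fun ?_)
  intro y
  classical
  simp only [Function.comp_apply, siteProj_single]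
  ext1; funext x
  rw [siteProj_apply]
  by_cases hxy : x = y
  · subst hxy; split_ifs <;> simp
  · have := hΘ.single_apply_of_ne hxy (ψ y)
    split_ifs <;> simp_all

/-- Conjugation `B ↦ Θ B Θ⁻¹ = -Θ B Θ` by a time-reversal symmetry, a (conjugate-linear) ring
homomorphism. -/
def IsTimeReversal.conj (hΘ : IsTimeReversal Θ) : Op S N →+* Op S N where
  toFun B := LinearMap.mkContinuous
    { toFun := fun ψ => -Θ (B (Θ ψ))
      map_add' := fun ψ φ => by simp only [map_add, neg_add]
      map_smul' := fun c ψ => by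
        rw [LinearMap.map_smulₛₗ, map_smul, LinearMap.map_smulₛₗ, Complex.conj_conj, smul_neg]
        rfl }
    ‖B‖ fun ψ => by
      change ‖-Θ (B (Θ ψ))‖ ≤ _
      rw [norm_neg, hΘ.norm_map, ← hΘ.norm_map ψ]
      exact B.le_opNorm _
  map_one' := by
    ext1 ψ
    change -Θ (Θ ψ) = ψ
    rw [hΘ.map_map, neg_neg]
  map_zero' := by
    ext1 ψ
    change -Θ 0 = 0
    rw [map_zero, neg_zero]
  map_add' B C := by
    ext1 ψ
    change -Θ (B (Θ ψ) + C (Θ ψ)) = -Θ (B (Θ ψ)) + -Θ (C (Θ ψ))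
    rw [map_add, neg_add]
  map_mul' B C := by
    ext1 ψ
    change -Θ (B (C (Θ ψ))) = -Θ (B (Θ (-Θ (C (Θ ψ)))))
    rw [map_neg, hΘ.map_map, neg_neg]

lemma IsTimeReversal.conj_apply (hΘ : IsTimeReversal Θ) (B : Op S N) (ψ : Space S N) :
    hΘ.conj B ψ = -Θ (B (Θ ψ)) := rfl

lemma IsTimeReversal.continuous_conj (hΘ : IsTimeReversal Θ) : Continuous hΘ.conj :=
  AddMonoidHomClass.continuous_of_bound hΘ.conj 1 fun B => by
    rw [one_mul]
    refine ContinuousLinearMap.opNorm_le_bound _ (norm_nonneg B) fun ψ => ?_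
    rw [hΘ.conj_apply, norm_neg, hΘ.norm_map, ← hΘ.norm_map ψ]
    exact B.le_opNorm _

lemma IsTimeReversal.conj_smul (hΘ : IsTimeReversal Θ) (c : ℂ) (B : Op S N) :
    hΘ.conj (c • B) = starRingEnd ℂ c • hΘ.conj B := by
  ext1 ψ
  rw [hΘ.conj_apply, smul_apply, LinearMap.map_smulₛₗ,
    smul_apply, hΘ.conj_apply, smul_neg]

lemma IsTimeReversal.conj_eq_self (hΘ : IsTimeReversal Θ) {B : Op S N}
    (hB : ∀ ψ, B (Θ ψ) = Θ (B ψ)) : hΘ.conj B = B := by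
  ext1 ψ
  rw [hΘ.conj_apply, hB, hΘ.map_map, neg_neg]

/-- With `Λ` and `A` commuting with `Θ`, conjugation of the adjoint of `Λ exp(-2πiA) Λ + (1 - Λ)`
by `Θ` conjugates the phase a second time and gives the operator back. -/
theorem IsTimeReversal.isThetaOdd_W (hΘ : IsTimeReversal Θ) (j : Direction) {A : Op S N}
    (hA : IsSelfAdjoint A) (hAΘ : IsTimeReversalInvariant Θ A) : IsThetaOdd Θ (W j A) := by
  let +nondep : NormedAlgebra ℚ (Op S N) := .restrictScalars ℚ ℂ (Op S N)
  have hP : hΘ.conj (halfSpaceProj j) = halfSpaceProj j :=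
    hΘ.conj_eq_self fun ψ => by
      rw [halfSpaceProj_eq_siteProj]; exact hΘ.siteProj_comm _ ψ
  have hPs : star (halfSpaceProj j : Op S N) = halfSpaceProj j := by
    rw [halfSpaceProj_eq_siteProj]; exact (isSelfAdjoint_siteProj _).star_eq
  have hA' : hΘ.conj A = A := hΘ.conj_eq_self hAΘ
  have hU : hΘ.conj (star (NormedSpace.exp ((-2 * (Real.pi : ℂ) * Complex.I) • A))) =
      NormedSpace.exp ((-2 * (Real.pi : ℂ) * Complex.I) • A) := by
    rw [NormedSpace.star_exp, NormedSpace.map_exp _ hΘ.continuous_conj, star_smul, hA.star_eq,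
      hΘ.conj_smul, hA']
    congr 2
    exact Complex.conj_conj _
  have hW : hΘ.conj (star (W j A)) = W j A := by
    unfold W compress
    rw [star_add, star_mul, star_mul, star_sub, star_one, hPs, map_add, map_mul, map_mul, map_sub,
      map_one, hP, hU, ← mul_assoc (halfSpaceProj j) (NormedSpace.exp _) (halfSpaceProj j)]
  intro ψ
  conv_lhs => rw [← hW]
  rfl

end TimeReversal

end MobilityGap

end

theorem mainTheorem3 (S : Set (ℤ × ℤ))
    (hS : S = MobilityGap.bulkSites ∨ S = MobilityGap.edgeSites)
    (N : ℕ) (hN : 1 ≤ N) :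
    (∀ A : MobilityGap.Op S N, MobilityGap.IsQuasiProjection .second A →
      (MobilityGap.W .first A).IsFredholm) ∧
    (∀ A : unitInterval → MobilityGap.Op S N, Continuous A →
      (∀ t, MobilityGap.IsQuasiProjection .second (A t)) →
      IsLocallyConstant (fun t => MobilityGap.index (MobilityGap.W .first (A t)))) ∧
    (∀ Θ : MobilityGap.Space S N →ₛₗ[starRingEnd ℂ] MobilityGap.Space S N,
      MobilityGap.IsTimeReversal Θ →
      (∀ A : MobilityGap.Op S N, MobilityGap.IsQuasiProjection .second A →
        MobilityGap.IsTimeReversalInvariant Θ A →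
        MobilityGap.IsThetaOdd Θ (MobilityGap.W .first A)) ∧
      (∀ A : unitInterval → MobilityGap.Op S N, Continuous A →
        (∀ t, MobilityGap.IsQuasiProjection .second (A t)) →
        (∀ t, MobilityGap.IsThetaOdd Θ (MobilityGap.W .first (A t))) →
        IsLocallyConstant (fun t => MobilityGap.indexTwo (MobilityGap.W .first (A t))))) := by
  refine ⟨fun A hA => MobilityGap.isFredholm_W hA, fun A hc hA => ?_, fun Θ hΘ =>
    ⟨fun A hA hAΘ => hΘ.isThetaOdd_W .first hA.isSelfAdjoint hAΘ, fun A hc hA hodd => ?_⟩⟩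
  · rw [IsLocallyConstant.iff_eventually_eq]
    intro t
    filter_upwards [((MobilityGap.continuous_W .first).comp hc).continuousAt.eventually
      (MobilityGap.eventually_index_eq (MobilityGap.isFredholm_W (hA t)))] with s hs
    exact hs (MobilityGap.isFredholm_W (hA s))
  · rw [IsLocallyConstant.iff_eventually_eq]
    intro t
    filter_upwards [((MobilityGap.continuous_W .first).comp hc).continuousAt.eventually
      (MobilityGap.eventually_finrank_ker_parity_eq hΘ.inner_map hΘ.map_map
        (MobilityGap.isFredholm_W (hA t)) (hodd t))] with s hs
    exact hs (hodd s)
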